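/- Let $n\ge 0$ be an integer and consider $n$ qubits, with Hilbert space $(\mathbb{C}^2)^{\otimes n}$. Let $\sigma_w^{(i)}$, $w\in\{x,z\}$, denote the Pauli operator $\sigma_w$ acting on qubit $i$, put $J_w=\frac12\sum_{i=1}^n\sigma_w^{(i)}$, and for $\theta\in\mathbb{R}$ let $R_x(\theta)=\exp(-i\theta J_x)$ be the global rotation by $\theta$ around the $x$-axis. Call a unitary on $(\mathbb{C}^2)^{\otimes n}$ permutationally invariant (PI) if it commutes with all permutations of the $n$ tensor factors. Then every PI unitary $U$ on $(\mathbb{C}^2)^{\otimes n}$ is a finite product $U=W_1W_2\cdots W_L$ in which each factor $W_k$ is either a global rotation $R_x(\theta)$ for some $\theta\in\mathbb{R}$, or a PI unitary that respects the $\mathrm{U}(1)$ symmetry of rotations around the $z$-axis, i.e. that commutes with $J_z$. The equality holds exactly, not merely up to a global phase. -/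

import Mathlib

namespace QubitSystem

/-- Labels `x : Fin n → Fin 2` of the computational basis vectors `|x⟩` of `(ℂ²)^{⊗ n}`. -/
abbrev BasisLabel (n : ℕ) : Type := Fin n → Fin 2

/-- Linear operators on `(ℂ²)^{⊗ n}`, written as matrices in the computational basis. -/
abbrev Operator (n : ℕ) : Type := Matrix (BasisLabel n) (BasisLabel n) ℂ

/-- The Pauli matrix `σ_x`. -/
def pauliX : Matrix (Fin 2) (Fin 2) ℂ := !![0, 1; 1, 0]

/-- The Pauli matrix `σ_z`. -/
def pauliZ : Matrix (Fin 2) (Fin 2) ℂ := !![1, 0; 0, -1]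

/-- The operator `I ⊗ ⋯ ⊗ A ⊗ ⋯ ⊗ I` with the one-qubit operator `A` acting on qubit `i`:
its entry `⟨x|·|y⟩` is `⟨x i|A|y i⟩` if `x` and `y` agree on all other qubits, and `0` otherwise. -/
def onQubit {n : ℕ} (i : Fin n) (A : Matrix (Fin 2) (Fin 2) ℂ) : Operator n :=
  Matrix.of fun x y => if ∀ k, k ≠ i → x k = y k then A (x i) (y i) else 0

/-- `J_x = (1/2) ∑ᵢ σ_x⁽ⁱ⁾`. -/
noncomputable def Jx (n : ℕ) : Operator n := (1 / 2 : ℂ) • ∑ i : Fin n, onQubit i pauliX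

/-- `J_z = (1/2) ∑ᵢ σ_z⁽ⁱ⁾`. -/
noncomputable def Jz (n : ℕ) : Operator n := (1 / 2 : ℂ) • ∑ i : Fin n, onQubit i pauliZ

/-- The global rotation `R_x(θ) = exp(-i θ J_x)` around the `x`-axis. -/
noncomputable def Rx (n : ℕ) (θ : ℝ) : Operator n :=
  NormedSpace.exp (-(Complex.I * (θ : ℂ)) • Jx n)

/-- The unitary operator that permutes the `n` tensor factors (qubits) according to `π`:
it sends `|y⟩` to `|y ∘ π⁻¹⟩`. -/
def permOp {n : ℕ} (π : Equiv.Perm (Fin n)) : Operator n :=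
  Matrix.of fun x y => if x = y ∘ ⇑π⁻¹ then 1 else 0

/-- `U` is a unitary that commutes with every permutation of the qubits. -/
def IsPIUnitary {n : ℕ} (U : Operator n) : Prop :=
  U ∈ Matrix.unitaryGroup (BasisLabel n) ℂ ∧ ∀ π : Equiv.Perm (Fin n), Commute U (permOp π)

end QubitSystem

/-!
The generated monoid `H` is in fact a group of unitaries, because the set of generators is closed
under adjoints. Its tangent space at `1` is a real Lie algebra; let `L` be its complex span. Then
`L` is closed under commutators and contains `J_x` and every permutation-invariant operator
commuting with `J_z`. The proof shows that `L` contains all permutation-invariant operators, and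
that a group of unitaries with such a large tangent space contains all permutation-invariant
unitaries. No decomposition into irreducible representations is used.

*The Lie algebra.* The commutator of `J_x` with `J_z` puts the ladder operators `e` and `f` into `L`.
The functions `D G` of the Hamming weight and the powers of the Casimir operator `C` commute with
`J_z`, so all `D G * C ^ b` lie in `L`. As every sequence `G` is a difference `Q - Q ∘ succ`,
commutators with `e` and `f` then yield all `e ^ k * D G * C ^ b` and `D G * C ^ b * f ^ k`. These span
the algebra generated by `e`, `f` and the `D G` (`adjoin_ladder_le`), which is the algebra of all
permutation-invariant operators: symmetrized tensor products are polynomials in the collective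
operators `∑ᵢ A⁽ⁱ⁾`, by induction on the number of nontrivial tensor factors
(`QubitSystem.piAlgebra_le_adjoin`).

*From the Lie algebra to the group.* Multiplying curves in `H` and applying the inverse function
theorem shows that `H` contains all permutation-invariant unitaries close to `1`
(`eventually_mem_of_skewAdjoint_mem_tangentSpaceOne`). Any permutation-invariant unitary is
`exp (I • K)` with `K` self-adjoint and permutation-invariant, hence the `m`-th power of
`exp ((I / m) • K)`, which is close to `1` for large `m`. Scalar phases commute with `J_z`, so
equality holds exactly and not only up to a phase.
-/

/-! ### Ladder operators and Lie subalgebras -/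

section Ladder

/-- Every sequence is the difference of a sequence and its shift. -/
theorem exists_sub_shift_eq (G : ℕ → ℂ) : ∃ Q : ℕ → ℂ, Q - Q ∘ Nat.succ = G := by
  refine ⟨fun m => -∑ j ∈ Finset.range m, G j, funext fun m => ?_⟩
  simp [Finset.sum_range_succ]

variable {R : Type*} [Ring R] [Algebra ℂ R] {D : (ℕ → ℂ) →ₐ[ℂ] R} {e f C : R} {c d : ℕ → ℂ}

/-- With `C` commuting with `e`, the commutator of `e` and `e ^ k * (D Q * C ^ b)` is
`e ^ (k + 1) * (D (Q - Q ∘ succ) * C ^ b)`. -/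
theorem raise_pow_mul_mem (L : Submodule ℂ R) (hL : ∀ x ∈ L, ∀ y ∈ L, x * y - y * x ∈ L)
    (hDe : ∀ G, D G * e = e * D (G ∘ Nat.succ)) (hCe : Commute C e) (he : e ∈ L)
    (hD : ∀ G b, D G * C ^ b ∈ L) (k b : ℕ) (G : ℕ → ℂ) : e ^ k * (D G * C ^ b) ∈ L := by
  induction k generalizing G with
  | zero => simpa using hD G b
  | succ k ih =>
    obtain ⟨Q, rfl⟩ := exists_sub_shift_eq G
    have h := hL _ he _ (ih Q)
    have hC : C ^ b * e = e * C ^ b := (hCe.pow_left b).eq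
    have : e * (e ^ k * (D Q * C ^ b)) - e ^ k * (D Q * C ^ b) * e
        = e ^ (k + 1) * (D (Q - Q ∘ Nat.succ) * C ^ b) := by
      rw [mul_assoc (e ^ k), mul_assoc (D Q), hC, ← mul_assoc (D Q), hDe, map_sub, pow_succ]
      simp only [mul_sub, sub_mul, ← mul_assoc]
      rw [← pow_succ', pow_succ]
    rwa [this] at h

theorem mul_lower_pow_mem (L : Submodule ℂ R) (hL : ∀ x ∈ L, ∀ y ∈ L, x * y - y * x ∈ L)
    (hfD : ∀ G, f * D G = D (G ∘ Nat.succ) * f) (hCf : Commute C f) (hf : f ∈ L)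
    (hD : ∀ G b, D G * C ^ b ∈ L) (k b : ℕ) (G : ℕ → ℂ) : D G * C ^ b * f ^ k ∈ L := by
  induction k generalizing G with
  | zero => simpa using hD G b
  | succ k ih =>
    obtain ⟨Q, rfl⟩ := exists_sub_shift_eq G
    have h := hL _ (ih Q) _ hf
    have hC : f * C ^ b = C ^ b * f := (hCf.symm.pow_right b).eq
    have : D Q * C ^ b * f ^ k * f - f * (D Q * C ^ b * f ^ k)
        = D (Q - Q ∘ Nat.succ) * C ^ b * f ^ (k + 1) := by
      rw [← mul_assoc f, ← mul_assoc f, hfD, mul_assoc (D (Q ∘ Nat.succ)), hC, map_sub,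
        pow_succ' f k]
      simp only [sub_mul, ← mul_assoc]
      rw [mul_assoc _ (f ^ k) f, ← pow_succ, pow_succ']
      simp only [← mul_assoc]
    rwa [this] at h

/-- If `D G` (`G : ℕ → ℂ`) are functions of a grading, `e` raises and `f` lowers the degree by one,
and `e f = C + D c`, `f e = C + D d` with `C` central, then a subspace closed under commutators that
contains `e`, `f` and all `D G * C ^ b` contains the whole algebra generated by `e`, `f` and the
`D G`. The normally ordered monomials `e ^ k * D G * C ^ b` and `D G * C ^ b * f ^ k` span that
algebra, and commutators with `e` and `f` produce all of them, by induction on `k`. -/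
theorem adjoin_ladder_le (L : Submodule ℂ R) (hL : ∀ x ∈ L, ∀ y ∈ L, x * y - y * x ∈ L)
    (hDe : ∀ G, D G * e = e * D (G ∘ Nat.succ)) (hfD : ∀ G, f * D G = D (G ∘ Nat.succ) * f)
    (hCe : Commute C e) (hCf : Commute C f) (hCD : ∀ G, Commute C (D G))
    (hef : e * f = C + D c) (hfe : f * e = C + D d) (he : e ∈ L) (hf : f ∈ L)
    (hD : ∀ G b, D G * C ^ b ∈ L) :
    Subalgebra.toSubmodule (Algebra.adjoin ℂ ({e, f} ∪ Set.range D)) ≤ L := by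
  have hE := raise_pow_mul_mem L hL hDe hCe he hD
  have hF := mul_lower_pow_mem L hL hfD hCf hf hD
  set M : Set R := {x | (∃ k b G, x = e ^ k * (D G * C ^ b)) ∨ ∃ k b G, x = D G * C ^ b * f ^ k}
  have hME : ∀ k b G, e ^ k * (D G * C ^ b) ∈ Submodule.span ℂ M :=
    fun k b G => Submodule.subset_span (Or.inl ⟨k, b, G, rfl⟩)
  have hMF : ∀ k b G, D G * C ^ b * f ^ k ∈ Submodule.span ℂ M :=
    fun k b G => Submodule.subset_span (Or.inr ⟨k, b, G, rfl⟩)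
  have hML : Submodule.span ℂ M ≤ L := by
    refine Submodule.span_le.2 ?_
    rintro x (⟨k, b, G, rfl⟩ | ⟨k, b, G, rfl⟩)
    exacts [hE k b G, hF k b G]
  have hCe' : ∀ b, C ^ b * e = e * C ^ b := fun b => (hCe.pow_left b).eq
  have hCf' : ∀ b, C ^ b * f = f * C ^ b := fun b => (hCf.pow_left b).eq
  have hCD' : ∀ b G, C ^ b * D G = D G * C ^ b := fun b G => ((hCD G).pow_left b).eq
  have hDf : ∀ G, D G * f = f * D (fun m => G (m - 1)) := fun G => by
    rw [hfD]; rfl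
  have hfkD : ∀ k G, ∃ G', f ^ k * D G = D G' * f ^ k := by
    intro k
    induction k with
    | zero => exact fun G => ⟨G, by simp⟩
    | succ k ih =>
      intro G
      obtain ⟨G', h⟩ := ih (G ∘ Nat.succ)
      exact ⟨G', by rw [pow_succ, mul_assoc, hfD, ← mul_assoc, h, mul_assoc]⟩
  have step : ∀ g ∈ ({e, f} ∪ Set.range D : Set R), ∀ x ∈ M, x * g ∈ Submodule.span ℂ M := by
    rintro g ((rfl | rfl) | ⟨H, rfl⟩) x (⟨k, b, G, rfl⟩ | ⟨k, b, G, rfl⟩)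
    · convert hME (k + 1) b (G ∘ Nat.succ) using 1
      rw [mul_assoc, mul_assoc, hCe', ← mul_assoc (D G), hDe, pow_succ]
      simp only [mul_assoc]
    · cases k with
      | zero =>
        convert hME 1 b (G ∘ Nat.succ) using 1
        rw [pow_zero, mul_one, mul_assoc, hCe', ← mul_assoc (D G), hDe, pow_one, mul_assoc]
      | succ k =>
        obtain ⟨G', h⟩ := hfkD k d
        have : D G * C ^ b * f ^ (k + 1) * g
            = D G * C ^ (b + 1) * f ^ k + D (G * G') * C ^ b * f ^ k := by
          rw [pow_succ f, mul_assoc, mul_assoc, mul_assoc (f ^ k), hfe, mul_add, h,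
            ← (hCf.pow_right k).eq, mul_add, map_mul, pow_succ C]
          simp only [mul_assoc]
          rw [← mul_assoc (C ^ b) (D G'), hCD']
          simp only [mul_assoc, mul_add]
        rw [this]
        exact add_mem (hMF _ _ _) (hMF _ _ _)
    · cases k with
      | zero =>
        convert hMF 1 b G using 1
        simp
      | succ k =>
        have : e ^ (k + 1) * (D G * C ^ b) * g
            = e ^ k * (D (fun m => G (m - 1)) * C ^ (b + 1))
              + e ^ k * (D (c * fun m => G (m - 1)) * C ^ b) := by
          rw [mul_assoc, mul_assoc, hCf', ← mul_assoc (D G), hDf, pow_succ, mul_assoc,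
            mul_assoc, ← mul_assoc e, hef, add_mul, mul_add, map_mul, pow_succ' C]
          rw [← mul_assoc C, (hCD _).eq]
          simp only [mul_assoc]
        rw [this]
        exact add_mem (hME _ _ _) (hME _ _ _)
    · convert hMF (k + 1) b G using 1
      rw [pow_succ]
      simp only [mul_assoc]
    · convert hME k b (G * H) using 1
      rw [mul_assoc, mul_assoc, hCD', map_mul]
      simp only [mul_assoc]
    · obtain ⟨H', h⟩ := hfkD k H
      convert hMF k b (G * H') using 1
      rw [mul_assoc, h, map_mul, ← mul_assoc, mul_assoc (D G), hCD']
      simp only [mul_assoc]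
  have step' : ∀ g ∈ ({e, f} ∪ Set.range D : Set R), ∀ x ∈ Submodule.span ℂ M,
      x * g ∈ Submodule.span ℂ M := by
    intro g hg x hx
    induction hx using Submodule.span_induction with
    | mem x hx => exact step g hg x hx
    | zero => simp
    | add x y _ _ hx hy => rw [add_mul]; exact add_mem hx hy
    | smul a x _ hx => rw [smul_mul_assoc]; exact Submodule.smul_mem _ _ hx
  intro y hy
  refine hML ?_
  have key : ∀ x ∈ Submodule.span ℂ M, x * y ∈ Submodule.span ℂ M := by
    change y ∈ Algebra.adjoin ℂ ({e, f} ∪ Set.range D) at hy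
    induction hy using Algebra.adjoin_induction with
    | mem g hg => exact step' g hg
    | algebraMap r =>
      intro x hx
      rw [← Algebra.commutes, ← Algebra.smul_def]
      exact Submodule.smul_mem _ _ hx
    | add y z _ _ hy hz => intro x hx; rw [mul_add]; exact add_mem (hy x hx) (hz x hx)
    | mul y z _ _ hy hz => intro x hx; rw [← mul_assoc]; exact hz _ (hy x hx)
  simpa using key 1 (by simpa using hME 0 0 1)

end Ladder

namespace QubitSystem

/-! ### Tensor products and collective operators -/

variable {n : ℕ}

/-- The operator `f 0 ⊗ f 1 ⊗ ⋯ ⊗ f (n - 1)`. -/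
def tensor (f : Fin n → Matrix (Fin 2) (Fin 2) ℂ) : Operator n :=
  Matrix.of fun x y => ∏ i, f i (x i) (y i)

/-- The collective operator `∑ᵢ A⁽ⁱ⁾`. -/
def collective (n : ℕ) : Matrix (Fin 2) (Fin 2) ℂ →ₗ[ℂ] Operator n where
  toFun A := ∑ i : Fin n, onQubit i A
  map_add' A B := by
    rw [← Finset.sum_add_distrib]
    refine Finset.sum_congr rfl fun i _ => ?_
    ext x y
    simp only [onQubit, Matrix.of_apply, Matrix.add_apply]
    split_ifs <;> simp
  map_smul' a A := by
    rw [RingHom.id_apply, Finset.smul_sum]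
    refine Finset.sum_congr rfl fun i _ => ?_
    ext x y
    simp only [onQubit, Matrix.of_apply, Matrix.smul_apply]
    split_ifs <;> simp

theorem collective_apply (A : Matrix (Fin 2) (Fin 2) ℂ) :
    collective n A = ∑ i : Fin n, onQubit i A := rfl

theorem tensor_mul (f g : Fin n → Matrix (Fin 2) (Fin 2) ℂ) :
    tensor f * tensor g = tensor (f * g) := by
  ext x y
  simp only [tensor, Matrix.mul_apply, Matrix.of_apply, Pi.mul_apply, Finset.prod_univ_sum,
    Fintype.piFinset_univ, Finset.prod_mul_distrib]

theorem tensor_one : tensor (1 : Fin n → Matrix (Fin 2) (Fin 2) ℂ) = 1 := by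
  ext x y
  simp only [tensor, Matrix.of_apply, Pi.one_apply, Matrix.one_apply, Finset.prod_ite_zero,
    Finset.mem_univ, true_imp_iff, Finset.prod_const_one, funext_iff]

theorem onQubit_eq_tensor (i : Fin n) (A : Matrix (Fin 2) (Fin 2) ℂ) :
    onQubit i A = tensor (Function.update 1 i A) := by
  ext x y
  simp only [onQubit, tensor, Matrix.of_apply]
  rw [← Finset.mul_prod_erase _ _ (Finset.mem_univ i), Function.update_self,
    Finset.prod_congr rfl (g := fun k => if x k = y k then 1 else 0), Finset.prod_ite_zero]
  · simp
  · intro k hk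
    rw [Function.update_of_ne (Finset.ne_of_mem_erase hk), Pi.one_apply, Matrix.one_apply]

theorem onQubit_mul_tensor (i : Fin n) (A : Matrix (Fin 2) (Fin 2) ℂ)
    (g : Fin n → Matrix (Fin 2) (Fin 2) ℂ) :
    onQubit i A * tensor g = tensor (Function.update g i (A * g i)) := by
  rw [onQubit_eq_tensor, tensor_mul]
  congr 1
  funext k
  rcases eq_or_ne k i with rfl | h <;> simp [*]

theorem onQubit_mul_onQubit (i : Fin n) (A B : Matrix (Fin 2) (Fin 2) ℂ) :
    onQubit i A * onQubit i B = onQubit i (A * B) := by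
  rw [onQubit_eq_tensor i B, onQubit_mul_tensor, onQubit_eq_tensor]
  simp

theorem onQubit_commute {i j : Fin n} (h : i ≠ j) (A B : Matrix (Fin 2) (Fin 2) ℂ) :
    onQubit i A * onQubit j B = onQubit j B * onQubit i A := by
  rw [onQubit_eq_tensor i A, onQubit_eq_tensor j B, tensor_mul, tensor_mul]
  congr 1
  funext k
  rcases eq_or_ne k i with rfl | hi
  · simp [h]
  · simp [hi]

/-- `A ↦ ∑ᵢ A⁽ⁱ⁾` is a homomorphism of Lie algebras. -/
theorem collective_mul_sub (A B : Matrix (Fin 2) (Fin 2) ℂ) :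
    collective n A * collective n B - collective n B * collective n A
      = collective n (A * B - B * A) := by
  rw [map_sub]
  simp only [collective_apply, Finset.sum_mul_sum]
  rw [Finset.sum_comm (s := Finset.univ) (t := Finset.univ)
    (f := fun i j => onQubit i B * onQubit j A), ← Finset.sum_sub_distrib,
    ← Finset.sum_sub_distrib]
  refine Finset.sum_congr rfl fun i _ => ?_
  rw [← Finset.sum_sub_distrib, Finset.sum_eq_single i]
  · simp only [onQubit_mul_onQubit]
  · intro j _ hj
    rw [onQubit_commute hj.symm, sub_self]
  · simp

theorem star_collective (A : Matrix (Fin 2) (Fin 2) ℂ) :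
    star (collective n A) = collective n (star A) := by
  simp only [collective_apply, star_sum]
  refine Finset.sum_congr rfl fun i _ => ?_
  ext x y
  simp only [onQubit, Matrix.star_apply, Matrix.of_apply, eq_comm (a := x _)]
  split_ifs <;> simp

/-! ### Permutation-invariant operators -/

theorem comp_perm_comp_inv (x : BasisLabel n) (π : Equiv.Perm (Fin n)) :
    (x ∘ π) ∘ ⇑π⁻¹ = x := by
  funext k; simp

theorem comp_inv_comp_perm (x : BasisLabel n) (π : Equiv.Perm (Fin n)) :
    (x ∘ ⇑π⁻¹) ∘ π = x := by
  funext k; simp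

theorem permOp_mul_apply (π : Equiv.Perm (Fin n)) (M : Operator n) (x y : BasisLabel n) :
    (permOp π * M) x y = M (x ∘ π) y := by
  rw [Matrix.mul_apply, Finset.sum_eq_single (x ∘ π)]
  · rw [permOp, Matrix.of_apply, comp_perm_comp_inv, if_pos rfl, one_mul]
  · rintro z - hz
    rw [permOp, Matrix.of_apply, if_neg, zero_mul]
    rintro rfl
    exact hz (comp_inv_comp_perm z π).symm
  · simp

theorem mul_permOp_apply (π : Equiv.Perm (Fin n)) (M : Operator n) (x y : BasisLabel n) :
    (M * permOp π) x y = M x (y ∘ ⇑π⁻¹) := by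
  rw [Matrix.mul_apply, Finset.sum_eq_single (y ∘ ⇑π⁻¹)]
  · rw [permOp, Matrix.of_apply, if_pos rfl, mul_one]
  · rintro z - hz
    rw [permOp, Matrix.of_apply, if_neg hz, mul_zero]
  · simp

/-- The algebra of permutation-invariant operators. -/
def piAlgebra (n : ℕ) : Subalgebra ℂ (Operator n) :=
  Subalgebra.centralizer ℂ (Set.range permOp)

theorem mem_piAlgebra_iff {M : Operator n} :
    M ∈ piAlgebra n ↔ ∀ π : Equiv.Perm (Fin n), Commute M (permOp π) := by
  simp [piAlgebra, Subalgebra.mem_centralizer_iff, Commute, SemiconjBy, eq_comm]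

theorem mem_piAlgebra_iff_apply {M : Operator n} :
    M ∈ piAlgebra n ↔ ∀ (π : Equiv.Perm (Fin n)) (x y), M (x ∘ π) (y ∘ π) = M x y := by
  rw [mem_piAlgebra_iff]
  refine forall_congr' fun π => ⟨fun h x y => ?_, fun h => ?_⟩
  · have := congr_fun₂ h.eq x (y ∘ π)
    rw [permOp_mul_apply, mul_permOp_apply] at this
    rw [← this, comp_perm_comp_inv]
  · ext x y
    rw [permOp_mul_apply, mul_permOp_apply, ← h x, comp_inv_comp_perm]

theorem star_mem_piAlgebra {M : Operator n} (h : M ∈ piAlgebra n) : star M ∈ piAlgebra n := by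
  rw [mem_piAlgebra_iff_apply] at h ⊢
  intro π x y
  simp [Matrix.star_apply, h]

theorem collective_mem_piAlgebra (A : Matrix (Fin 2) (Fin 2) ℂ) :
    collective n A ∈ piAlgebra n := by
  rw [mem_piAlgebra_iff_apply]
  intro π x y
  simp only [collective_apply, Matrix.sum_apply]
  rw [← Equiv.sum_comp π (fun i => onQubit i A x y)]
  refine Finset.sum_congr rfl fun i _ => ?_
  simp only [onQubit, Matrix.of_apply, Function.comp_apply]
  congr 1
  refine propext ⟨fun h k hk => ?_, fun h k hk => h _ (by simpa using hk)⟩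
  simpa using h (π.symm k) (by rintro rfl; simp at hk)

/-- The sum of the operators obtained from `f 0 ⊗ ⋯ ⊗ f (n - 1)` by permuting the factors. -/
def symTensor (f : Fin n → Matrix (Fin 2) (Fin 2) ℂ) : Operator n :=
  ∑ π : Equiv.Perm (Fin n), tensor (f ∘ π)

theorem symTensor_comp (f : Fin n → Matrix (Fin 2) (Fin 2) ℂ) (σ : Equiv.Perm (Fin n)) :
    symTensor (f ∘ σ) = symTensor f := by
  unfold symTensor
  rw [← Equiv.sum_comp (Equiv.mulLeft σ) (fun π : Equiv.Perm (Fin n) => tensor (f ∘ π))]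
  rfl

theorem collective_mul_symTensor (A : Matrix (Fin 2) (Fin 2) ℂ)
    (g : Fin n → Matrix (Fin 2) (Fin 2) ℂ) :
    collective n A * symTensor g = ∑ i, symTensor (Function.update g i (A * g i)) := by
  simp only [collective_apply, symTensor]
  rw [Finset.sum_mul_sum, Finset.sum_comm, Finset.sum_comm (s := Finset.univ (α := Fin n))]
  refine Finset.sum_congr rfl fun π _ => ?_
  rw [← Equiv.sum_comp π (fun i => tensor (Function.update g i (A * g i) ∘ π))]
  refine Finset.sum_congr rfl fun i _ => ?_
  rw [onQubit_mul_tensor, Function.update_comp_eq_of_injective _ π.injective]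
  rfl

/-- Symmetrized tensor products are polynomials in the collective operators. If `g` is obtained from
`f` by replacing one factor `f i₀` by the identity, then `collective n (f i₀) * symTensor g` is a
positive multiple of `symTensor f` plus symmetrized products with fewer nontrivial factors. -/
theorem symTensor_mem_adjoin (f : Fin n → Matrix (Fin 2) (Fin 2) ℂ) :
    symTensor f ∈ Algebra.adjoin ℂ (Set.range (collective n)) := by
  classical
  induction hk : (Finset.univ.filter fun i => f i ≠ 1).card using Nat.strong_induction_on
    generalizing f with
  | _ k ih =>
  by_cases hf : ∃ i₀, f i₀ ≠ 1
  · obtain ⟨i₀, hi₀⟩ := hf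
    set g := Function.update f i₀ 1 with hg
    set s := Finset.univ.filter fun i => g i ≠ 1 with hs
    have hcard : s.card < k := by
      rw [← hk]
      refine Finset.card_lt_card (Finset.ssubset_iff_of_subset ?_ |>.2 ⟨i₀, ?_, ?_⟩)
      · intro i hi
        rcases eq_or_ne i i₀ with rfl | h
        · simpa using hi₀
        · simpa [hs, hg, h] using hi
      · simpa using hi₀
      · simp [hs, hg]
    have hmul := collective_mul_symTensor (f i₀) g
    rw [← Finset.sum_filter_add_sum_filter_not _ (fun i => g i ≠ 1)] at hmul
    have h1 : ∑ i with ¬ g i ≠ 1, symTensor (Function.update g i (f i₀ * g i))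
        = ((Finset.univ.filter fun i => ¬ g i ≠ 1).card : ℂ) • symTensor f := by
      rw [Nat.cast_smul_eq_nsmul, ← Finset.sum_const]
      refine Finset.sum_congr rfl fun i hi => ?_
      have hgi : g i = 1 := by simpa using hi
      rw [hgi, mul_one, ← symTensor_comp f (Equiv.swap i i₀)]
      congr 1
      funext j
      rcases eq_or_ne j i with rfl | hj
      · simp
      rcases eq_or_ne j i₀ with rfl | hj₀
      · rw [Function.update_of_ne hj, Function.comp_apply, Equiv.swap_apply_right]
        rw [hg, Function.update_of_ne hj.symm] at hgi
        rw [hgi, hg, Function.update_self]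
      · rw [Function.update_of_ne hj, Function.comp_apply, Equiv.swap_apply_of_ne_of_ne hj hj₀,
          hg, Function.update_of_ne hj₀]
    have hne : ((Finset.univ.filter fun i => ¬ g i ≠ 1).card : ℂ) ≠ 0 := by
      rw [Nat.cast_ne_zero, Finset.card_ne_zero]
      exact ⟨i₀, by simp [hg]⟩
    rw [h1] at hmul
    have hsum : ∑ i with g i ≠ 1, symTensor (Function.update g i (f i₀ * g i))
        ∈ Algebra.adjoin ℂ (Set.range (collective n)) := by
      refine sum_mem fun i hi => ih _ ?_ _ rfl
      refine lt_of_le_of_lt (Finset.card_le_card fun j hj => ?_) hcard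
      rcases eq_or_ne j i with rfl | h
      · exact hi
      · simpa [hs, h] using hj
    rw [← inv_smul_smul₀ hne (symTensor f), eq_sub_of_add_eq' hmul.symm]
    refine Subalgebra.smul_mem _ (sub_mem (mul_mem ?_ ?_) hsum) _
    · exact Algebra.subset_adjoin ⟨_, rfl⟩
    · exact ih _ hcard _ rfl
  · push Not at hf
    obtain rfl : f = 1 := funext hf
    have : symTensor (1 : Fin n → Matrix (Fin 2) (Fin 2) ℂ)
        = (Fintype.card (Equiv.Perm (Fin n)) : Operator n) := by
      simp only [symTensor, show ∀ π : Equiv.Perm (Fin n),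
        (1 : Fin n → Matrix (Fin 2) (Fin 2) ℂ) ∘ π = 1 from fun _ => rfl, tensor_one]
      simp
    rw [this]
    exact natCast_mem _ _

/-- The permutation-invariant operators are generated, as an algebra, by the collective ones. -/
theorem piAlgebra_le_adjoin : piAlgebra n ≤ Algebra.adjoin ℂ (Set.range (collective n)) := by
  intro M hM
  rw [mem_piAlgebra_iff_apply] at hM
  have hcard : (Fintype.card (Equiv.Perm (Fin n)) : ℂ) ≠ 0 := by simp
  -- Averaging the expansion of `M` in matrix units over all permutations.
  have h : (Fintype.card (Equiv.Perm (Fin n)) : ℂ) • M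
      = ∑ a, ∑ b, M a b • symTensor fun i => Matrix.single (a i) (b i) (1 : ℂ) := by
    have hs : ∀ (a b x y : BasisLabel n), (∏ i, Matrix.single (a i) (b i) (1 : ℂ) (x i) (y i))
        = if a = x ∧ b = y then 1 else 0 := by
      intro a b x y
      simp only [Matrix.single, Matrix.of_apply, Finset.prod_ite_zero, Finset.prod_const_one,
        funext_iff, Finset.mem_univ, true_imp_iff, forall_and]
    ext x y
    simp only [Matrix.sum_apply, Matrix.smul_apply, symTensor, tensor, Matrix.of_apply,
      Function.comp_apply, smul_eq_mul, Finset.mul_sum]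
    have hs' : ∀ (a b : BasisLabel n) (π : Equiv.Perm (Fin n)),
        M a b * ∏ i, Matrix.single (a (π i)) (b (π i)) (1 : ℂ) (x i) (y i)
          = if a = x ∘ ⇑π⁻¹ then if b = y ∘ ⇑π⁻¹ then M x y else 0 else 0 := by
      intro a b π
      rw [show (∏ i, Matrix.single (a (π i)) (b (π i)) (1 : ℂ) (x i) (y i))
        = if a ∘ π = x ∧ b ∘ π = y then 1 else 0 from hs (a ∘ π) (b ∘ π) x y]
      have hiff : ∀ u v : BasisLabel n, u ∘ π = v ↔ u = v ∘ ⇑π⁻¹ := fun u v =>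
        ⟨fun h => by rw [← h, comp_perm_comp_inv], fun h => by rw [h, comp_inv_comp_perm]⟩
      simp only [hiff]
      by_cases ha : a = x ∘ ⇑π⁻¹ <;> by_cases hb : b = y ∘ ⇑π⁻¹ <;> simp only [ha, hb] <;> simp
      exact hM π⁻¹ x y
    simp only [hs']
    rw [Finset.sum_congr rfl fun a _ => Finset.sum_comm, Finset.sum_comm]
    simp
  rw [← inv_smul_smul₀ hcard M, h]
  exact Subalgebra.smul_mem _ (sum_mem fun a _ => sum_mem fun b _ =>
    Subalgebra.smul_mem _ (symTensor_mem_adjoin _) _) _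

/-! ### The grading by the number of ones -/

/-- The Hamming weight of a basis label. -/
def weight (x : BasisLabel n) : ℕ := ∑ i, (x i : ℕ)

/-- The diagonal operator `|x⟩ ↦ G (weight x) |x⟩`, as a homomorphism in `G`. -/
def diag (n : ℕ) : (ℕ → ℂ) →ₐ[ℂ] Operator n where
  toFun G := Matrix.diagonal fun x => G (weight x)
  map_one' := Matrix.diagonal_one
  map_mul' G H := by simp
  map_zero' := Matrix.diagonal_zero
  map_add' G H := by simp
  commutes' a := rfl

theorem diag_apply (G : ℕ → ℂ) : diag n G = Matrix.diagonal fun x => G (weight x) := rfl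

theorem weight_comp (x : BasisLabel n) (π : Equiv.Perm (Fin n)) : weight (x ∘ π) = weight x :=
  Equiv.sum_comp π fun i => (x i : ℕ)

theorem diag_mem_piAlgebra (G : ℕ → ℂ) : diag n G ∈ piAlgebra n := by
  rw [mem_piAlgebra_iff_apply]
  intro π x y
  simp only [diag_apply, Matrix.diagonal_apply, weight_comp]
  congr 1
  exact propext ⟨fun h => by rw [← comp_perm_comp_inv x π, h, comp_perm_comp_inv],
    fun h => by rw [h]⟩

theorem weight_eq_add {x y : BasisLabel n} {i : Fin n} (h : ∀ k, k ≠ i → x k = y k) :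
    weight x + y i = weight y + x i := by
  have : ∑ k ∈ Finset.univ.erase i, (x k : ℕ) = ∑ k ∈ Finset.univ.erase i, (y k : ℕ) :=
    Finset.sum_congr rfl fun k hk => by rw [h k (Finset.ne_of_mem_erase hk)]
  rw [weight, weight, ← Finset.add_sum_erase _ _ (Finset.mem_univ i),
    ← Finset.add_sum_erase _ (fun k => (y k : ℕ)) (Finset.mem_univ i), this]
  omega

/-- The collective operator that raises the weight by one. -/
def raising (n : ℕ) : Operator n := collective n !![0, 0; 1, 0]

/-- The collective operator that lowers the weight by one. -/
def lowering (n : ℕ) : Operator n := collective n !![0, 1; 0, 0]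

theorem weight_eq_of_raising_ne_zero {x y : BasisLabel n} (h : raising n x y ≠ 0) :
    weight x = weight y + 1 := by
  rw [raising, collective_apply, Matrix.sum_apply] at h
  obtain ⟨i, -, hi⟩ := Finset.exists_ne_zero_of_sum_ne_zero h
  rw [onQubit, Matrix.of_apply, ite_ne_right_iff] at hi
  have hw := weight_eq_add hi.1
  have := hi.2
  generalize x i = a at *
  generalize y i = b at *
  fin_cases a <;> fin_cases b <;> simp_all

theorem star_raising : star (raising n) = lowering n := by
  rw [raising, lowering, star_collective]
  congr 1
  ext a b
  fin_cases a <;> fin_cases b <;> simp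

theorem diag_mul_raising (G : ℕ → ℂ) :
    diag n G * raising n = raising n * diag n (G ∘ Nat.succ) := by
  ext x y
  rw [diag_apply, diag_apply, Matrix.diagonal_mul, Matrix.mul_diagonal]
  by_cases h : raising n x y = 0
  · simp [h]
  · rw [weight_eq_of_raising_ne_zero h, mul_comm]
    rfl

theorem star_diag (G : ℕ → ℂ) : star (diag n G) = diag n (star G) := by
  rw [diag_apply, diag_apply, Matrix.star_eq_conjTranspose, Matrix.diagonal_conjTranspose]
  rfl

theorem lowering_mul_diag (G : ℕ → ℂ) :
    lowering n * diag n G = diag n (G ∘ Nat.succ) * lowering n := by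
  have := congr_arg star (diag_mul_raising (n := n) (star G))
  rw [star_mul, star_mul, star_raising, star_diag, star_diag, star_star] at this
  rw [this]
  congr 2
  funext m
  simp

theorem collective_diagonal (a b : ℂ) :
    collective n !![a, 0; 0, b] = diag n fun m => a * (n - m) + b * m := by
  ext x y
  rw [collective_apply, Matrix.sum_apply, diag_apply, Matrix.diagonal_apply]
  split_ifs with h
  · subst h
    have h1 : ∀ i, onQubit i !![a, 0; 0, b] x x = a + (b - a) * ((x i : ℕ) : ℂ) := by
      intro i
      simp only [onQubit, Matrix.of_apply, implies_true, if_true]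
      generalize x i = c
      fin_cases c <;> simp
    simp only [h1, Finset.sum_add_distrib, ← Finset.mul_sum, weight]
    push_cast
    simp
    ring
  · refine Finset.sum_eq_zero fun i _ => ?_
    rw [onQubit, Matrix.of_apply, ite_eq_right_iff]
    intro hi
    have : x i ≠ y i := fun hxy => h (funext fun k => by
      rcases eq_or_ne k i with rfl | hk
      exacts [hxy, hi k hk])
    generalize x i = c at *
    generalize y i = d at *
    fin_cases c <;> fin_cases d <;> simp_all

theorem lowering_raising :
    lowering n * raising n - raising n * lowering n = diag n fun m => (n : ℂ) - 2 * m := by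
  rw [lowering, raising, collective_mul_sub]
  convert collective_diagonal (n := n) 1 (-1) using 2
  · ext a b
    fin_cases a <;> fin_cases b <;> simp
  · funext m
    ring

/-- `J_z` is a function of the weight, since `|0⟩` is the eigenvector of `σ_z` for `1`. -/
theorem Jz_eq_diag : Jz n = diag n fun m => (n : ℂ) / 2 - m := by
  rw [Jz, ← collective_apply, pauliZ, collective_diagonal, ← map_smul]
  congr 1
  funext m
  simp
  ring

theorem Jx_eq : Jx n = (1 / 2 : ℂ) • (raising n + lowering n) := by
  rw [Jx, ← collective_apply, raising, lowering, ← map_add]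
  congr 2
  ext a b
  fin_cases a <;> fin_cases b <;> simp [pauliX]

/-- The Casimir operator `J_x² + J_y² + J_z²`, up to an additive constant. -/
def casimir (n : ℕ) : Operator n :=
  raising n * lowering n + diag n fun m => (m : ℂ) * (m - 1 - n)

theorem casimir_commute_raising : Commute (casimir n) (raising n) := by
  have h1 : lowering n * raising n = raising n * lowering n + diag n fun m => (n : ℂ) - 2 * m := by
    rw [← lowering_raising]; abel
  rw [Commute, SemiconjBy, casimir, add_mul, mul_assoc, h1, diag_mul_raising, ← mul_add, add_assoc,
    ← map_add]
  congr 3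
  funext m
  simp
  ring

theorem star_casimir : star (casimir n) = casimir n := by
  rw [casimir, star_add, star_mul, star_diag, ← star_raising, star_star]
  congr 2
  funext m
  simp

theorem casimir_commute_lowering : Commute (casimir n) (lowering n) := by
  have := (casimir_commute_raising (n := n)).star_star
  rwa [star_casimir, star_raising] at this

theorem casimir_commute_diag (G : ℕ → ℂ) : Commute (casimir n) (diag n G) := by
  refine Commute.add_left ?_ ?_
  · rw [Commute, SemiconjBy, mul_assoc, lowering_mul_diag, ← mul_assoc, ← mul_assoc,
      ← diag_mul_raising]
  · rw [Commute, SemiconjBy, ← map_mul, ← map_mul, mul_comm]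

theorem casimir_mem_piAlgebra : casimir n ∈ piAlgebra n :=
  add_mem (mul_mem (collective_mem_piAlgebra _) (collective_mem_piAlgebra _))
    (diag_mem_piAlgebra _)

/-- A complex subspace of operators that is closed under commutators and contains `J_x` and all
permutation-invariant operators commuting with `J_z` contains all permutation-invariant
operators. -/
theorem piAlgebra_le_of_commutator_mem (L : Submodule ℂ (Operator n))
    (hL : ∀ x ∈ L, ∀ y ∈ L, x * y - y * x ∈ L) (hx : Jx n ∈ L)
    (hz : ∀ a ∈ piAlgebra n, Commute a (Jz n) → a ∈ L) : ∀ a ∈ piAlgebra n, a ∈ L := by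
  have hD : ∀ G b, diag n G * casimir n ^ b ∈ L := by
    intro G b
    refine hz _ (mul_mem (diag_mem_piAlgebra _) (pow_mem casimir_mem_piAlgebra _)) ?_
    rw [Jz_eq_diag]
    refine Commute.mul_left ?_ ((casimir_commute_diag _).pow_left b)
    rw [Commute, SemiconjBy, ← map_mul, ← map_mul, mul_comm]
  have hsum : raising n + lowering n ∈ L := by
    have := L.smul_mem 2 hx
    rwa [Jx_eq, smul_smul, show (2 : ℂ) * (1 / 2) = 1 by norm_num, one_smul] at this
  -- The commutator with the weight operator separates the two ladder operators.
  have hdiff : raising n - lowering n ∈ L := by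
    set w : ℕ → ℂ := fun m => m
    have hw : diag n w ∈ L := by simpa using hD w 0
    have hs : w ∘ Nat.succ = w + 1 := by
      funext m; simp [w]
    have h1 := diag_mul_raising (n := n) w
    have h2 := lowering_mul_diag (n := n) w
    rw [hs, map_add, map_one] at h1 h2
    have := hL _ hw _ hsum
    rwa [mul_add, add_mul, h1, h2, mul_add, add_mul, mul_one, one_mul,
      show ∀ a b c d : Operator n, a + b + c - (a + (c + d)) = b - d by intros; abel] at this
  have he : raising n ∈ L := by
    have := L.smul_mem (1 / 2) (L.add_mem hsum hdiff)
    rwa [show ∀ a b : Operator n, a + b + (a - b) = (2 : ℂ) • a by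
      intros; rw [two_smul]; abel, smul_smul, show (1 / 2 : ℂ) * 2 = 1 by norm_num,
      one_smul] at this
  have hf : lowering n ∈ L := by
    have := L.sub_mem hsum he
    rwa [add_sub_cancel_left] at this
  have hef : raising n * lowering n
      = casimir n + diag n (fun m => -((m : ℂ) * (m - 1 - n))) := by
    rw [casimir, add_assoc, ← map_add, eq_comm, add_eq_left, ← map_zero (diag n)]
    congr 1
    funext m
    simp
  have hfe : lowering n * raising n = casimir n
      + diag n ((fun m : ℕ => -((m : ℂ) * (m - 1 - n))) + fun m : ℕ => (n : ℂ) - 2 * m) := by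
    rw [map_add, ← add_assoc, ← hef, ← lowering_raising]
    abel
  have hadj := adjoin_ladder_le L hL diag_mul_raising lowering_mul_diag casimir_commute_raising
    casimir_commute_lowering casimir_commute_diag hef hfe he hf hD
  intro a ha
  refine hadj ?_
  have hle : Algebra.adjoin ℂ (Set.range (collective n))
      ≤ Algebra.adjoin ℂ ({raising n, lowering n} ∪ Set.range (diag n)) := by
    refine Algebra.adjoin_le ?_
    rintro _ ⟨A, rfl⟩
    have : collective n A = A 1 0 • raising n + A 0 1 • lowering n
        + diag n fun m => A 0 0 * (n - m) + A 1 1 * m := by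
      rw [raising, lowering, ← collective_diagonal, ← (collective n).map_smul, ← (collective n).map_smul,
        ← (collective n).map_add, ← (collective n).map_add]
      congr 1
      ext i j
      fin_cases i <;> fin_cases j <;> simp
    rw [this]
    refine add_mem (add_mem (Subalgebra.smul_mem _ ?_ _) (Subalgebra.smul_mem _ ?_ _)) ?_
    all_goals exact Algebra.subset_adjoin (by simp)
  exact hle (piAlgebra_le_adjoin ha)

end QubitSystem

open scoped Topology

/-! ### Tangent spaces of groups of unitaries -/

section Tangent

variable {A : Type*} [CStarAlgebra A]

/-- The tangent space at `1` of a submonoid `H` of a C⋆-algebra: the velocities at `0` of the curves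
`γ : ℝ → A` inside `H` with `γ 0 = 1`. The curves are only required to be strictly differentiable at
`0`, which is what the inverse function theorem needs. -/
def tangentSpaceOne (H : Submonoid A) : Submodule ℝ A where
  carrier := {X | ∃ γ : ℝ → A, γ 0 = 1 ∧ (∀ t, γ t ∈ H) ∧ HasStrictDerivAt γ X 0}
  add_mem' := by
    rintro X Y ⟨γ, h0, hγ, hX⟩ ⟨η, k0, hη, hY⟩
    refine ⟨fun t => γ t * η t, by simp [h0, k0], fun t => mul_mem (hγ t) (hη t), ?_⟩
    have := hX.mul hY
    rw [h0, k0, mul_one, one_mul] at this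
    exact this
  zero_mem' := ⟨fun _ => 1, rfl, fun _ => one_mem _, hasStrictDerivAt_const _ _⟩
  smul_mem' := by
    rintro c X ⟨γ, h0, hγ, hX⟩
    refine ⟨fun t => γ (c * t), by simp [h0], fun t => hγ _, ?_⟩
    have h1 : HasStrictDerivAt (fun t : ℝ => c * t) c 0 := by
      simpa using (hasStrictDerivAt_id (0 : ℝ)).const_mul c
    have h2 : HasStrictDerivAt γ X (c * 0) := by simpa using hX
    exact h2.scomp 0 h1

theorem star_eq_neg_of_mem_tangentSpaceOne {H : Submonoid A} (hH : H ≤ unitary A) {X : A}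
    (hX : X ∈ tangentSpaceOne H) : star X = -X := by
  obtain ⟨γ, h0, hγ, hX⟩ := hX
  have h1 := hX.hasDerivAt.mul hX.hasDerivAt.star
  have h2 : (γ * fun t => star (γ t)) = fun _ => 1 :=
    funext fun t => Unitary.mul_star_self_of_mem (hH (hγ t))
  rw [h2] at h1
  have := h1.unique (hasDerivAt_const _ _)
  rw [h0, star_one, mul_one, one_mul] at this
  exact eq_neg_of_add_eq_zero_right this

/-- The tangent space of a group of unitaries is a Lie algebra: it is stable under conjugation by
`γ t` for every curve `γ` in the group, and the derivative of `γ t * Y * (γ t)⁻¹` at `t = 0` is a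
commutator. -/
theorem commutator_mem_tangentSpaceOne [FiniteDimensional ℂ A] {H : Submonoid A}
    (hH : H ≤ unitary A) (hstar : ∀ h ∈ H, star h ∈ H) {X Y : A} (hX : X ∈ tangentSpaceOne H)
    (hY : Y ∈ tangentSpaceOne H) : X * Y - Y * X ∈ tangentSpaceOne H := by
  have : FiniteDimensional ℝ A := FiniteDimensional.complexToReal A
  have hXs := star_eq_neg_of_mem_tangentSpaceOne hH hX
  obtain ⟨γ, h0, hγ, hX⟩ := hX
  have hconj : ∀ t, γ t * Y * star (γ t) ∈ tangentSpaceOne H := by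
    intro t
    obtain ⟨η, k0, hη, hY⟩ := hY
    refine ⟨fun s => γ t * η s * star (γ t), ?_, fun s =>
      mul_mem (mul_mem (hγ t) (hη s)) (hstar _ (hγ t)), (hY.const_mul _).mul_const _⟩
    simp only [k0, mul_one]
    exact Unitary.mul_star_self_of_mem (hH (hγ t))
  have hd : HasDerivAt (fun t => γ t * Y * star (γ t)) (X * Y - Y * X) 0 := by
    have := (hX.hasDerivAt.mul_const Y).mul hX.hasDerivAt.star
    simp only [h0, star_one, mul_one, one_mul, hXs, mul_neg, ← sub_eq_add_neg] at this
    exact this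
  have hclosed : IsClosed (tangentSpaceOne H : Set A) := Submodule.closed_of_finiteDimensional _
  refine hclosed.mem_of_tendsto (hasDerivAt_iff_tendsto_slope.1 hd) (Filter.Eventually.of_forall ?_)
  intro t
  rw [slope_def_module]
  exact Submodule.smul_mem _ _ (sub_mem (hconj t) (hconj 0))

theorem mem_tangentSpaceOne_of_exp_mem {H : Submonoid A} {X : A}
    (h : ∀ t : ℝ, NormedSpace.exp (t • X) ∈ H) : X ∈ tangentSpaceOne H := by
  refine ⟨fun t => NormedSpace.exp (t • X), by simp, h, ?_⟩
  have := hasStrictDerivAt_exp_smul_const (𝕂 := ℝ) X 0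
  rw [zero_smul, NormedSpace.exp_zero, one_mul] at this
  exact this

/-- The complex span of the tangent space of `H` at `1`. -/
def complexTangentSpaceOne (H : Submonoid A) : Submodule ℂ A where
  carrier := {a | ∃ X ∈ tangentSpaceOne H, ∃ Y ∈ tangentSpaceOne H, a = X + Complex.I • Y}
  add_mem' := by
    rintro _ _ ⟨X, hX, Y, hY, rfl⟩ ⟨X', hX', Y', hY', rfl⟩
    exact ⟨X + X', add_mem hX hX', Y + Y', add_mem hY hY', by module⟩
  zero_mem' := ⟨0, zero_mem _, 0, zero_mem _, by simp⟩
  smul_mem' := by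
    rintro c _ ⟨X, hX, Y, hY, rfl⟩
    refine ⟨c.re • X - c.im • Y, sub_mem (Submodule.smul_mem _ _ hX) (Submodule.smul_mem _ _ hY),
      c.im • X + c.re • Y, add_mem (Submodule.smul_mem _ _ hX) (Submodule.smul_mem _ _ hY), ?_⟩
    simp only [← Complex.coe_smul]
    nth_rw 1 [← Complex.re_add_im c]
    have hI := Complex.I_mul_I
    match_scalars
    · ring
    · linear_combination (c.im : ℂ) * hI

theorem mem_complexTangentSpaceOne {H : Submonoid A} {X : A} (hX : X ∈ tangentSpaceOne H) :
    X ∈ complexTangentSpaceOne H :=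
  ⟨X, hX, 0, zero_mem _, by simp⟩

theorem commutator_mem_complexTangentSpaceOne [FiniteDimensional ℂ A] {H : Submonoid A}
    (hH : H ≤ unitary A) (hstar : ∀ h ∈ H, star h ∈ H) {a b : A}
    (ha : a ∈ complexTangentSpaceOne H) (hb : b ∈ complexTangentSpaceOne H) :
    a * b - b * a ∈ complexTangentSpaceOne H := by
  obtain ⟨X, hX, Y, hY, rfl⟩ := ha
  obtain ⟨X', hX', Y', hY', rfl⟩ := hb
  have h {Z W : A} (hZ : Z ∈ tangentSpaceOne H) (hW : W ∈ tangentSpaceOne H) :=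
    commutator_mem_tangentSpaceOne hH hstar hZ hW
  refine ⟨_, sub_mem (h hX hX') (h hY hY'), _, add_mem (h hX hY') (h hY hX'), ?_⟩
  simp only [mul_add, add_mul, smul_mul_assoc, mul_smul_comm]
  have hI := Complex.I_mul_I
  match_scalars <;> first | ring1 | linear_combination hI | linear_combination -hI

theorem mem_tangentSpaceOne_of_star_eq_neg {H : Submonoid A} (hH : H ≤ unitary A) {a : A}
    (ha : a ∈ complexTangentSpaceOne H) (hs : star a = -a) : a ∈ tangentSpaceOne H := by
  obtain ⟨X, hX, Y, hY, rfl⟩ := ha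
  have h1 := star_eq_neg_of_mem_tangentSpaceOne hH hX
  have h2 := star_eq_neg_of_mem_tangentSpaceOne hH hY
  rw [star_add, star_smul, h1, h2, Complex.star_def, Complex.conj_I, neg_smul_neg, neg_add,
    add_right_inj] at hs
  have h3 : Complex.I • Y = 0 := by
    have h4 : (2 : ℂ) • (Complex.I • Y) = 0 := by
      rw [two_smul]
      nth_rw 1 [hs]
      exact neg_add_cancel _
    exact (smul_eq_zero.1 h4).resolve_left two_ne_zero
  rwa [h3, add_zero]

/-- An element lies in the complex span of the tangent space as soon as its skew-adjoint part and
that of `-I • a` generate one-parameter groups in `H`. -/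
theorem mem_complexTangentSpaceOne_of_exp_mem {H : Submonoid A} {S : Submodule ℂ A}
    (hS : ∀ a ∈ S, star a ∈ S) (h : ∀ X ∈ S, star X = -X → NormedSpace.exp X ∈ H) {a : A}
    (ha : a ∈ S) : a ∈ complexTangentSpaceOne H := by
  have key : ∀ X ∈ S, star X = -X → X ∈ tangentSpaceOne H := fun X hX hs =>
    mem_tangentSpaceOne_of_exp_mem fun t => h _ (by
      rw [← Complex.coe_smul]
      exact S.smul_mem _ hX) (by rw [star_smul, hs, star_trivial, smul_neg])
  refine ⟨(1 / 2 : ℂ) • (a - star a), key _ (S.smul_mem _ (S.sub_mem ha (hS a ha))) ?_,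
    (-(Complex.I / 2)) • (a + star a), key _ (S.smul_mem _ (S.add_mem ha (hS a ha))) ?_, ?_⟩
  · rw [star_smul, star_sub, star_star, ← smul_neg, neg_sub]
    simp
  · rw [star_smul, star_add, star_star, ← neg_smul, add_comm (star a)]
    congr 1
    simp [neg_div]
  · have hI := Complex.I_mul_I
    match_scalars <;> linear_combination (1 / 2 : ℂ) * hI

/-- The derivative at `0` of `t ↦ ∏ᵢ γ i (t i)`, for curves through `1` with velocities `X i`, is
`v ↦ ∑ᵢ v i • X i`. -/
theorem hasStrictFDerivAt_list_prod_curves {ι : Type*} [Fintype ι] {γ : ι → ℝ → A} {X : ι → A}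
    (h0 : ∀ i, γ i 0 = 1) (hγ : ∀ i, HasStrictDerivAt (γ i) (X i) 0) (l : List ι) :
    HasStrictFDerivAt (fun t : ι → ℝ => (l.map fun i => γ i (t i)).prod)
      (l.map fun i => (ContinuousLinearMap.proj (R := ℝ) (φ := fun _ : ι => ℝ) i).smulRight
        (X i)).sum 0 := by
  induction l with
  | nil => simpa using hasStrictFDerivAt_const (1 : A) (0 : ι → ℝ)
  | cons i l ih =>
    have h1 : HasStrictFDerivAt (fun t : ι → ℝ => γ i (t i))
        ((ContinuousLinearMap.proj (R := ℝ) (φ := fun _ : ι => ℝ) i).smulRight (X i)) 0 := by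
      have h2 : HasStrictDerivAt (γ i) (X i) ((0 : ι → ℝ) i) := hγ i
      refine (h2.hasStrictFDerivAt.comp (0 : ι → ℝ)
        (ContinuousLinearMap.proj (R := ℝ) (φ := fun _ : ι => ℝ) i).hasStrictFDerivAt).congr_fderiv
        ?_
      ext v
      simp
    simp only [List.map_cons, List.prod_cons, List.sum_cons]
    refine (h1.mul' ih).congr_fderiv ?_
    ext v
    simp [h0, add_comm]

/-- If the tangent space of a group `H` of unitaries of `B` contains all skew-adjoint elements of
`B`, then `H` contains all unitaries of `B` close to `1`. -/
theorem eventually_mem_of_skewAdjoint_mem_tangentSpaceOne [FiniteDimensional ℂ A]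
    {H : Submonoid A} (hH : H ≤ unitary A) (B : StarSubalgebra ℂ A) (hHB : ∀ h ∈ H, h ∈ B)
    (hB : ∀ X ∈ B, star X = -X → X ∈ tangentSpaceOne H) :
    ∀ᶠ U in 𝓝 (1 : A), U ∈ B → U ∈ unitary A → U ∈ H := by
  have : FiniteDimensional ℝ A := FiniteDimensional.complexToReal A
  let b := Module.finBasis ℝ (tangentSpaceOne H)
  choose γ h0 hγ hX using fun i => (b i).2
  -- A linear projection `E` onto `B`, the skew-adjoint part `σ` of `E`, and `T = 1 - σ`.
  obtain ⟨E, hE⟩ := LinearMap.exists_leftInverse_of_injective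
    (Subalgebra.toSubmodule B.toSubalgebra).subtype (Submodule.ker_subtype _)
  have hE' : ∀ x (hx : x ∈ B), (E x : A) = x := fun x hx =>
    congr_arg Subtype.val (LinearMap.congr_fun hE ⟨x, hx⟩)
  have hEB : ∀ x, (E x : A) ∈ B := fun x => (E x).2
  let σ : A →ₗ[ℝ] A :=
    { toFun := fun Y => (1 / 2 : ℝ) • ((E Y : A) - star (E Y : A))
      map_add' := fun Y Z => by
        simp only [map_add, Submodule.coe_add, star_add, smul_sub, smul_add]
        abel
      map_smul' := fun c Y => by
        have : E (c • Y) = (c : ℂ) • E Y := by rw [← map_smul, Complex.coe_smul]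
        rw [this, Submodule.coe_smul, star_smul, Complex.star_def, Complex.conj_ofReal,
          ← smul_sub, Complex.coe_smul, RingHom.id_apply, smul_comm] }
  have hσ : ∀ Y, σ Y = (1 / 2 : ℝ) • ((E Y : A) - star (E Y : A)) := fun _ => rfl
  have hσB : ∀ Y, σ Y ∈ B := fun Y => by
    rw [hσ, ← Complex.coe_smul]
    exact SMulMemClass.smul_mem _ (sub_mem (hEB Y) (star_mem (hEB Y)))
  have hσs : ∀ Y, star (σ Y) = -σ Y := fun Y => by
    rw [hσ, star_smul, star_sub, star_star, ← smul_neg, neg_sub, star_trivial]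
  let T : A →L[ℝ] A := LinearMap.toContinuousLinearMap (LinearMap.id - σ)
  have hT : ∀ Y, T Y = Y - σ Y := fun _ => rfl
  let F : (Fin (Module.finrank ℝ (tangentSpaceOne H)) → ℝ) → A :=
    fun t => ((List.finRange _).map fun i => γ i (t i)).prod
  have hF := hasStrictFDerivAt_list_prod_curves h0 hX (List.finRange _)
  set F' := ((List.finRange _).map fun i => (ContinuousLinearMap.proj (R := ℝ)
    (φ := fun _ => ℝ) i).smulRight (b i : A)).sum with hF'
  have hF0 : F 0 = 1 := by simp [F, h0]
  have hFH : ∀ t, F t ∈ H := fun t => Submonoid.list_prod_mem _ (by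
    simp only [List.mem_map]
    rintro _ ⟨i, -, rfl⟩
    exact hγ i _)
  -- `(t, Y) ↦ F t * (1 + T Y)` is a submersion at `0`.
  have hΦ : HasStrictFDerivAt
      (fun p : (Fin (Module.finrank ℝ (tangentSpaceOne H)) → ℝ) × A => F p.1 * (1 + T p.2))
      (F'.comp (ContinuousLinearMap.fst ℝ _ _) + T.comp (ContinuousLinearMap.snd ℝ _ _)) 0 := by
    have h1 := HasStrictFDerivAt.comp (0 : (Fin (Module.finrank ℝ (tangentSpaceOne H)) → ℝ) × A)
      (g := F) (f := Prod.fst) hF hasStrictFDerivAt_fst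
    have h2 := HasStrictFDerivAt.const_add (1 : A) (T.hasStrictFDerivAt.comp (f := Prod.snd)
      (0 : (Fin (Module.finrank ℝ (tangentSpaceOne H)) → ℝ) × A) hasStrictFDerivAt_snd)
    refine (h1.mul' h2).congr_fderiv ?_
    ext v <;> simp [hF0]
  have hsurj : (F'.comp (ContinuousLinearMap.fst ℝ _ _)
      + T.comp (ContinuousLinearMap.snd ℝ _ _)).range = ⊤ := by
    refine LinearMap.range_eq_top.2 fun Z => ?_
    have hZ := hB (σ Z) (hσB Z) (hσs Z)
    refine ⟨(b.repr ⟨σ Z, hZ⟩, Z), ?_⟩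
    have hsum : ∀ (l : List (Fin (Module.finrank ℝ (tangentSpaceOne H)))) v,
        (l.map fun i => (ContinuousLinearMap.proj (R := ℝ)
          (φ := fun _ => ℝ) i).smulRight (b i : A)).sum v
          = (l.map fun i => v i • (b i : A)).sum := by
      intro l v
      induction l with
      | nil => simp
      | cons i l ih => simp [ih]
    have h1 : F' (b.repr ⟨σ Z, hZ⟩) = σ Z := by
      rw [hF', hsum, ← Fin.sum_univ_def]
      have := congr_arg Subtype.val (b.sum_repr ⟨σ Z, hZ⟩)
      rwa [Submodule.coe_sum] at this
    change F' (b.repr ⟨σ Z, hZ⟩) + T Z = Z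
    rw [h1, hT]
    abel
  have hmap := hΦ.map_nhds_eq_of_surj hsurj
  rw [Prod.fst_zero, Prod.snd_zero, hF0, map_zero, add_zero, mul_one] at hmap
  rw [← hmap, Filter.eventually_map]
  have hunit : ∀ᶠ p : (Fin (Module.finrank ℝ (tangentSpaceOne H)) → ℝ) × A in 𝓝 0,
      IsUnit (1 + (1 + T p.2)) := by
    have hc : Continuous fun p : (Fin (Module.finrank ℝ (tangentSpaceOne H)) → ℝ) × A =>
      1 + (1 + T p.2) := by fun_prop
    refine hc.continuousAt.eventually (Units.isOpen.mem_nhds ?_)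
    have h2 : IsUnit (algebraMap ℂ A 2) := (IsUnit.mk0 2 two_ne_zero).map _
    rw [map_ofNat] at h2
    simpa [one_add_one_eq_two] using h2
  filter_upwards [hunit] with p hp hpB hpU
  -- The factor `V = 1 + T Y` is unitary, self-adjoint, and `1 + V` is invertible; hence `V = 1`.
  set V := 1 + T p.2 with hV
  have hFu := hH (hFH p.1)
  have hVeq : V = star (F p.1) * (F p.1 * V) := by
    rw [← mul_assoc, Unitary.star_mul_self_of_mem hFu, one_mul]
  have hVB : V ∈ B := by
    rw [hVeq]
    exact mul_mem (star_mem (hHB _ (hFH _))) hpB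
  have hVU : V ∈ unitary A := by
    rw [hVeq]
    exact mul_mem (Unitary.star_mem hFu) hpU
  have hTB : T p.2 ∈ B := by
    have := sub_mem hVB (one_mem B)
    rwa [hV, add_sub_cancel_left] at this
  have hTs : star (T p.2) = T p.2 := by
    have h1 := hE' _ hTB
    have h2 : (E (T p.2) : A) = E p.2 - σ p.2 := by
      rw [hT, map_sub, Submodule.coe_sub, hE' _ (hσB _)]
    have h3 : (E p.2 : A) - σ p.2 = (1 / 2 : ℝ) • ((E p.2 : A) + star (E p.2 : A)) := by
      rw [hσ]
      module
    rw [← h1, h2, h3, star_smul, star_add, star_star, star_trivial, add_comm]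
  have hVs : star V = V := by rw [hV, star_add, star_one, hTs]
  have hVV : V * V = 1 := by
    have := Unitary.mul_star_self_of_mem hVU
    rwa [hVs] at this
  have hV1 : V = 1 := by
    have : (1 + V) * (V - 1) = (1 + V) * 0 := by
      rw [add_mul, mul_sub V, hVV]; simp
    exact sub_eq_zero.1 (hp.mul_left_cancel this)
  rw [hV1, mul_one]
  exact hFH _

/-- The argument is continuous on a finite spectrum, whether or not `-1` belongs to it, so the
functional calculus provides a logarithm of every unitary with finite spectrum. -/
theorem exists_exp_I_smul_eq (B : StarSubalgebra ℂ A) [IsClosed (B : Set A)] {U : A}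
    (hU : U ∈ unitary A) (hUB : U ∈ B) (hfin : (spectrum ℂ U).Finite) :
    ∃ K ∈ B, IsSelfAdjoint K ∧ NormedSpace.exp (Complex.I • K) = U := by
  have : IsStarNormal U := ⟨by rw [Commute, SemiconjBy, Unitary.star_mul_self_of_mem hU,
    Unitary.mul_star_self_of_mem hU]⟩
  refine ⟨cfc (fun z => (z.arg : ℂ)) U, cfc_mem _ hUB, .cfc_arg U, ?_⟩
  have hc : ContinuousOn (fun z : ℂ => (z.arg : ℂ)) (spectrum ℂ U) := hfin.continuousOn _
  rw [← CFC.complex_exp_eq_normedSpace_exp, ← cfc_smul .., ← cfc_comp' ..]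
  conv_rhs => rw [← cfc_id ℂ U]
  refine cfc_congr fun z hz => ?_
  have hz1 := spectrum.norm_eq_one_of_unitary hU hz
  have := Complex.norm_mul_exp_arg_mul_I z
  rw [hz1, Complex.ofReal_one, one_mul] at this
  rw [smul_eq_mul, mul_comm, this, id]

/-- If the tangent space of a group `H` of unitaries of `B` contains all skew-adjoint elements of
`B`, then `H` contains all unitaries of `B`, as these are powers of unitaries close to `1`. -/
theorem mem_of_skewAdjoint_mem_tangentSpaceOne [FiniteDimensional ℂ A]
    {H : Submonoid A} (hH : H ≤ unitary A) (B : StarSubalgebra ℂ A) (hHB : ∀ h ∈ H, h ∈ B)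
    (hB : ∀ X ∈ B, star X = -X → X ∈ tangentSpaceOne H) {U : A} (hU : U ∈ unitary A)
    (hUB : U ∈ B) (hfin : (spectrum ℂ U).Finite) : U ∈ H := by
  let +nondep : NormedAlgebra ℚ A := .restrictScalars ℚ ℂ A
  have hcl : IsClosed (B : Set A) :=
    Submodule.closed_of_finiteDimensional (Subalgebra.toSubmodule B.toSubalgebra)
  obtain ⟨K, hKB, hK, hexp⟩ := exists_exp_I_smul_eq B hU hUB hfin
  have hc : Continuous fun t : ℝ => NormedSpace.exp (t • (Complex.I • K)) := by
    have := NormedSpace.exp_continuous (𝔸 := A)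
    fun_prop
  have h0 : Filter.Tendsto (fun m : ℕ => NormedSpace.exp ((1 / ((m : ℝ) + 1)) • (Complex.I • K)))
      Filter.atTop (𝓝 1) := by
    have := (hc.tendsto 0).comp tendsto_one_div_add_atTop_nhds_zero_nat
    simpa [Function.comp_def] using this
  obtain ⟨m, hm⟩ :=
    (h0.eventually (eventually_mem_of_skewAdjoint_mem_tangentSpaceOne hH B hHB hB)).exists
  have hmem := hm ?_ ?_
  · have := pow_mem hmem (m + 1)
    rw [← NormedSpace.exp_nsmul, ← Nat.cast_smul_eq_nsmul ℝ, smul_smul] at this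
    rwa [Nat.cast_add, Nat.cast_one, mul_one_div_cancel (by positivity), one_smul, hexp] at this
  · refine NormedSpace.exp_mem (s := B) hcl ?_
    rw [← Complex.coe_smul]
    exact SMulMemClass.smul_mem _ (SMulMemClass.smul_mem _ hKB)
  · refine NormedSpace.exp_mem_unitary_of_mem_skewAdjoint ?_
    rw [skewAdjoint.mem_iff, star_smul, star_smul, hK.star_eq]
    simp

end Tangent

/-! ### Generation of the permutation-invariant unitaries -/

namespace QubitSystem

open scoped Matrix.Norms.L2Operator

variable {n : ℕ}

/-- The star algebra of permutation-invariant operators. -/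
def piStarAlgebra (n : ℕ) : StarSubalgebra ℂ (Operator n) where
  toSubalgebra := piAlgebra n
  star_mem' := star_mem_piAlgebra

theorem isPIUnitary_iff {U : Operator n} :
    IsPIUnitary U ↔ U ∈ unitary (Operator n) ∧ U ∈ piStarAlgebra n :=
  and_congr Iff.rfl mem_piAlgebra_iff.symm

/-- The monoid generated by the global rotations around the `x`-axis and the permutation-invariant
unitaries commuting with `J_z`. -/
def generated (n : ℕ) : Submonoid (Operator n) :=
  Submonoid.closure {W | (∃ θ : ℝ, W = Rx n θ) ∨ (IsPIUnitary W ∧ Commute W (Jz n))}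

theorem Jx_mem_piAlgebra : Jx n ∈ piAlgebra n :=
  Subalgebra.smul_mem _ (collective_mem_piAlgebra pauliX) _

theorem star_Jx : star (Jx n) = Jx n := by
  rw [Jx_eq, star_smul, star_add, ← star_raising, star_star, add_comm]
  simp

theorem star_Jz : star (Jz n) = Jz n := by
  rw [Jz_eq_diag, star_diag]
  congr 1
  funext m
  simp

theorem exp_mem_unitary {X : Operator n} (hX : star X = -X) :
    NormedSpace.exp X ∈ unitary (Operator n) := by
  let +nondep : NormedAlgebra ℚ (Operator n) := .restrictScalars ℚ ℂ _
  exact NormedSpace.exp_mem_unitary_of_mem_skewAdjoint (skewAdjoint.mem_iff.2 hX)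

theorem exp_mem_piAlgebra {X : Operator n} (hX : X ∈ piAlgebra n) :
    NormedSpace.exp X ∈ piAlgebra n := by
  let +nondep : NormedAlgebra ℚ (Operator n) := .restrictScalars ℚ ℂ _
  exact mem_piAlgebra_iff.2 fun π => (mem_piAlgebra_iff.1 hX π).exp_left

theorem star_neg_I_smul_Jx (θ : ℝ) :
    star (-(Complex.I * (θ : ℂ)) • Jx n) = -(-(Complex.I * (θ : ℂ)) • Jx n) := by
  rw [star_smul, star_Jx, ← neg_smul]
  simp

theorem isPIUnitary_Rx (θ : ℝ) : IsPIUnitary (Rx n θ) :=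
  isPIUnitary_iff.2 ⟨exp_mem_unitary (star_neg_I_smul_Jx θ),
    exp_mem_piAlgebra (Subalgebra.smul_mem _ Jx_mem_piAlgebra _)⟩

theorem star_Rx (θ : ℝ) : star (Rx n θ) = Rx n (-θ) := by
  rw [Rx, Rx, NormedSpace.star_exp, star_neg_I_smul_Jx, ← neg_smul]
  simp

theorem isPIUnitary_of_mem_generated {U : Operator n} (hU : U ∈ generated n) :
    IsPIUnitary U := by
  have h : generated n ≤ unitary (Operator n) ⊓ (piAlgebra n).toSubsemiring.toSubmonoid := by
    refine Submonoid.closure_le.2 ?_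
    rintro W (⟨θ, rfl⟩ | ⟨hW, -⟩)
    exacts [isPIUnitary_iff.1 (isPIUnitary_Rx θ), isPIUnitary_iff.1 hW]
  exact isPIUnitary_iff.2 (h hU)

theorem star_mem_generated {U : Operator n} (hU : U ∈ generated n) : star U ∈ generated n := by
  induction hU using Submonoid.closure_induction with
  | mem W hW =>
    refine Submonoid.subset_closure ?_
    rcases hW with ⟨θ, rfl⟩ | ⟨hW, hz⟩
    · exact Or.inl ⟨-θ, star_Rx θ⟩
    · rw [isPIUnitary_iff] at hW
      refine Or.inr ⟨isPIUnitary_iff.2 ⟨Unitary.star_mem hW.1, star_mem hW.2⟩, ?_⟩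
      have := hz.star_star
      rwa [star_Jz] at this
  | one => rw [star_one]; exact one_mem _
  | mul U V _ _ hU hV => rw [star_mul]; exact mul_mem hV hU

theorem skewAdjoint_mem_tangentSpaceOne_generated {X : Operator n} (hX : X ∈ piAlgebra n)
    (hs : star X = -X) : X ∈ tangentSpaceOne (generated n) := by
  have hH : generated n ≤ unitary (Operator n) :=
    fun U hU => (isPIUnitary_of_mem_generated hU).1
  refine mem_tangentSpaceOne_of_star_eq_neg hH ?_ hs
  refine piAlgebra_le_of_commutator_mem (complexTangentSpaceOne (generated n))
    (fun x hx y hy => commutator_mem_complexTangentSpaceOne hH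
      (fun U hU => star_mem_generated hU) hx hy) ?_ ?_ X hX
  · have h : -Complex.I • Jx n ∈ tangentSpaceOne (generated n) := by
      refine mem_tangentSpaceOne_of_exp_mem fun θ => Submonoid.subset_closure (Or.inl ⟨θ, ?_⟩)
      rw [Rx, ← Complex.coe_smul, smul_smul]
      congr 2
      ring
    have := Submodule.smul_mem _ Complex.I (mem_complexTangentSpaceOne h)
    rwa [smul_smul, mul_neg, Complex.I_mul_I, neg_neg, one_smul] at this
  · intro a ha hz
    let S : Submodule ℂ (Operator n) :=
      Subalgebra.toSubmodule (piAlgebra n ⊓ Subalgebra.centralizer ℂ {Jz n})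
    have hS : ∀ b, b ∈ S ↔ b ∈ piAlgebra n ∧ Commute b (Jz n) := by
      intro b
      change b ∈ piAlgebra n ∧ b ∈ Subalgebra.centralizer ℂ {Jz n} ↔ _
      simp [Subalgebra.mem_centralizer_iff, Commute, SemiconjBy, eq_comm]
    refine mem_complexTangentSpaceOne_of_exp_mem (S := S) (fun b hb => ?_) (fun Y hY hYs => ?_)
      ((hS a).2 ⟨ha, hz⟩)
    · rw [hS] at hb ⊢
      refine ⟨star_mem_piAlgebra hb.1, ?_⟩
      have := hb.2.star_star
      rwa [star_Jz] at this
    · rw [hS] at hY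
      let +nondep : NormedAlgebra ℚ (Operator n) := .restrictScalars ℚ ℂ _
      exact Submonoid.subset_closure (Or.inr ⟨isPIUnitary_iff.2
        ⟨exp_mem_unitary hYs, exp_mem_piAlgebra hY.1⟩, hY.2.exp_left⟩)

end QubitSystem

open scoped Matrix.Norms.L2Operator in
theorem QubitSystem.IsPIUnitary.mem_generated {n : ℕ} {U : QubitSystem.Operator n}
    (hU : QubitSystem.IsPIUnitary U) : U ∈ QubitSystem.generated n := by
  rw [QubitSystem.isPIUnitary_iff] at hU
  exact mem_of_skewAdjoint_mem_tangentSpaceOne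
    (fun V hV => (QubitSystem.isPIUnitary_of_mem_generated hV).1) (QubitSystem.piStarAlgebra n)
    (fun V hV => (QubitSystem.isPIUnitary_iff.1 (QubitSystem.isPIUnitary_of_mem_generated hV)).2)
    (fun X hX hs => QubitSystem.skewAdjoint_mem_tangentSpaceOne_generated hX hs)
    hU.1 hU.2 (Matrix.finite_spectrum U)

theorem lemma5 (n : ℕ) (U : QubitSystem.Operator n) (hU : QubitSystem.IsPIUnitary U) :
    ∃ L : List (QubitSystem.Operator n),
      (∀ W ∈ L, (∃ θ : ℝ, W = QubitSystem.Rx n θ) ∨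
        (QubitSystem.IsPIUnitary W ∧ Commute W (QubitSystem.Jz n))) ∧
      L.prod = U :=
  Submonoid.exists_list_of_mem_closure hU.mem_generated
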